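/- Let $\Sigma$ be an alphabet with exactly two letters. For $k\in\mathbb N_0$, words $u,v\in\Sigma^*$ are Simon $k$-congruent, $u\sim_k v$, if they have the same scattered factors (subsequences) of length at most $k$. An arch is a word over $\Sigma$ that contains every letter of $\Sigma$ and whose last letter occurs exactly once in it. Every $w\in\Sigma^*$ has a unique factorization $w=a_1\cdots a_m r$ in which $a_1,\dots,a_m$ are arches ($m\ge 0$) and $r$ does not contain all letters of $\Sigma$; one says that $w$ has $m$ arches. Let the numbers $c_k^m$, for integers $k$ and $m\ge -1$, be given by $c_k^{-1}=1$, $c_k^0=2k+1$ and $$c_k^m = 2(k-m+1)\,c_{k-1}^{m-1}-2(k-m)\,c_{k-2}^{m-2}\qquad(m\ge 1).$$ Theorem. For all integers $0\le m<k$, the number of $\sim_k$-classes of words over $\Sigma$ with exactly $m$ arches is finite and equals $$\left\lVert\begin{pmatrix}k-m&k-m&k-m\\1&2&1\\k-m&k-m&k-m\end{pmatrix}^{m}\begin{pmatrix}k-m\\1\\k-m\end{pmatrix}\right\rVert_1=c_k^m,$$ where $\lVert\cdot\rVert_1$ denotes the $1$-norm (the sum of the absolute values of the entries). -/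

import Mathlib

/-- The set `ScatFact_{≤k}(w)` of scattered factors (subsequences) of `w` of length at most `k`. -/
def scatFactLE {A : Type*} (k : ℕ) (w : List A) : Set (List A) :=
  {u | u.Sublist w ∧ u.length ≤ k}

/-- Simon's congruence `∼_k`, as an equivalence relation on words over `A`. -/
def simonSetoid (A : Type*) (k : ℕ) : Setoid (List A) :=
  Setoid.ker (scatFactLE k)

/-- An arch over the alphabet `A`: a word that contains every letter of `A` and whose last letter
occurs exactly once in it. -/
def IsArch {A : Type*} (a : List A) : Prop :=
  (∀ y : A, y ∈ a) ∧ ∃ (u : List A) (x : A), a = u ++ [x] ∧ x ∉ u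

/-- `(arches, rest)` is the arch factorization of `w` over the alphabet `A`: the word `w` is the
concatenation of the arches and the rest, and the rest misses some letter of `A`. -/
structure IsArchFactorization {A : Type*} (w : List A) (arches : List (List A)) (rest : List A) :
    Prop where
  eq_append : w = arches.flatten ++ rest
  isArch : ∀ a ∈ arches, IsArch a
  rest_missing : ∃ y : A, y ∉ rest

/-- The word `w` over the alphabet `A` has exactly `m` arches. -/
def HasArches {A : Type*} (w : List A) (m : ℕ) : Prop :=
  ∃ (arches : List (List A)) (rest : List A),
    IsArchFactorization w arches rest ∧ arches.length = m

/-- The congruence classes of `∼_k` of words with `m` arches. -/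
def simonClasses (A : Type*) (k m : ℕ) : Set (Quotient (simonSetoid A k)) :=
  {q | ∃ w : List A, HasArches w m ∧ Quotient.mk (simonSetoid A k) w = q}

/-- The numbers `c_k^m` with the upper index shifted by one, `archRecAux k j = c_k^{j-1}`. -/
def archRecAux : ℤ → ℕ → ℤ
  | _, 0 => 1
  | k, 1 => 2 * k + 1
  | k, j + 2 =>
      2 * (k - (j + 1) + 1) * archRecAux (k - 1) (j + 1) - 2 * (k - (j + 1)) * archRecAux (k - 2) j

/-- The numbers `c_k^m`, for an integer `k` and an integer `m ≥ -1`; see the three facts below,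
which determine them. -/
def archRec (k m : ℤ) : ℤ :=
  archRecAux k (m + 1).toNat

theorem archRec_neg_one (k : ℤ) : archRec k (-1) = 1 := by
  simp [archRec, archRecAux]

theorem archRec_zero (k : ℤ) : archRec k 0 = 2 * k + 1 := by
  simp [archRec, archRecAux]

theorem archRec_rec (k m : ℤ) (hm : 1 ≤ m) :
    archRec k m =
      2 * (k - m + 1) * archRec (k - 1) (m - 1) - 2 * (k - m) * archRec (k - 2) (m - 2) := by
  obtain ⟨j, rfl⟩ : ∃ j : ℕ, m = (j : ℤ) + 1 := ⟨(m - 1).toNat, by omega⟩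
  have h1 : ((j : ℤ) + 1 + 1).toNat = j + 2 := by omega
  have h2 : ((j : ℤ) + 1 - 1 + 1).toNat = j + 1 := by omega
  have h3 : ((j : ℤ) + 1 - 2 + 1).toNat = j := by omega
  simp only [archRec, h1, h2, h3, archRecAux]

/-- The matrix `D_{k,m}`. -/
def archMatrix (k m : ℕ) : Matrix (Fin 3) (Fin 3) ℝ :=
  !![(k : ℝ) - m, (k : ℝ) - m, (k : ℝ) - m;
     1, 2, 1;
     (k : ℝ) - m, (k : ℝ) - m, (k : ℝ) - m]

/-- The vector `(k - m, 1, k - m)ᵀ`. -/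
def archVector (k m : ℕ) : Fin 3 → ℝ :=
  ![(k : ℝ) - m, 1, (k : ℝ) - m]


/-!
Over two letters, a word with `m` arches can be written `α₀ β₁ α₁ ⋯ βₘ αₘ`, where each `αᵢ` is a
power of a letter, the `αᵢ βᵢ₊₁` are the arches read from the left and the `βᵢ αᵢ` are the arches
read from the right. Let `k = t + m`. The last letters of the arches read from the right form a
word of length `m` whose rightmost embedding leaves exactly `α₀`, so the `∼_k`-class determines
`α₀` up to `∼_t`; cancelling the first arch lowers the order of the congruence by one, and
induction determines all the blocks in this way. Conversely, everything around a block is universal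
enough that its exponent may be truncated at `t` without leaving the class. Between two consecutive
blocks there is exactly one possible link `βᵢ`, except that two empty blocks allow two. Hence the
classes are counted by a transfer matrix whose three states are the letter of the first block, or
its emptiness.
-/

open scoped Finset List

/-! ### Scattered factors -/

section ScatteredFactors

variable {A B : Type*} {n k : ℕ} {a u v w w' X z : List A} {r : A}

theorem cons_sublist_append_cons_iff (hr : r ∉ z) : r :: v <+ z ++ r :: X ↔ v <+ X := by
  induction z with
  | nil => exact List.cons_sublist_cons
  | cons b z ih =>
    obtain ⟨hrb, hrz⟩ := not_or.1 (List.mem_cons.not.1 hr)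
    rw [List.cons_append, List.cons_sublist_cons', ih hrz]
    simp only [hrb, false_and, or_false]

theorem append_singleton_sublist_append_cons_iff (hr : r ∉ z) :
    v ++ [r] <+ X ++ r :: z ↔ v <+ X := by
  rw [← List.reverse_sublist, ← List.reverse_sublist (l₁ := v)]
  simpa using cons_sublist_append_cons_iff (v := v.reverse) (X := X.reverse)
    (List.mem_reverse.not.2 hr)

theorem eq_of_scatFactLE_eq (hu : u.length ≤ k) (hv : v.length ≤ k)
    (h : scatFactLE k u = scatFactLE k v) : u = v :=
  (h.le ⟨.refl u, hu⟩).1.antisymm (h.ge ⟨.refl v, hv⟩).1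

theorem scatFactLE_replicate_min (k n : ℕ) (r : A) :
    scatFactLE k (List.replicate (min n k) r) = scatFactLE k (List.replicate n r) := by
  ext u
  refine and_congr_left fun hlen ↦ ?_
  simp only [List.sublist_replicate_iff, le_min_iff]
  constructor
  · rintro ⟨i, ⟨hi, -⟩, rfl⟩
    exact ⟨i, hi, rfl⟩
  · rintro ⟨i, hi, rfl⟩
    exact ⟨i, ⟨hi, by simpa using hlen⟩, rfl⟩

theorem scatFactLE_map (e : A ≃ B) (k : ℕ) (w : List A) :
    scatFactLE k (w.map e) = List.map e '' scatFactLE k w := by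
  ext u
  constructor
  · rintro ⟨hu, hlen⟩
    obtain ⟨v, hv, rfl⟩ := List.sublist_map_iff.1 hu
    exact ⟨v, ⟨hv, by simpa using hlen⟩, rfl⟩
  · rintro ⟨v, ⟨hv, hlen⟩, rfl⟩
    exact ⟨hv.map e, by simpa using hlen⟩

theorem scatFactLE_map_inj (e : A ≃ B) :
    scatFactLE k (w.map e) = scatFactLE k (w'.map e) ↔ scatFactLE k w = scatFactLE k w' := by
  rw [scatFactLE_map, scatFactLE_map]
  exact (List.map_injective_iff.2 e.injective).image_injective.eq_iff

/-- `n`-universality of `w`: every word of length at most `n` is a scattered factor of `w`. -/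
def IsUniversal (n : ℕ) (w : List A) : Prop :=
  ∀ u : List A, u.length ≤ n → u <+ w

theorem isUniversal_one_of_forall_mem (hw : ∀ y, y ∈ w) : IsUniversal 1 w
  | [], _ => List.nil_sublist w
  | [y], _ => List.singleton_sublist.2 (hw y)

theorem scatFactLE_append_left_subset (ha : IsUniversal n a)
    (h : scatFactLE k w ⊆ scatFactLE k w') :
    scatFactLE (k + n) (a ++ w) ⊆ scatFactLE (k + n) (a ++ w') := by
  rintro u ⟨hu, hlen⟩
  refine ⟨?_, hlen⟩
  obtain ⟨p, q, rfl, hp, hq⟩ := List.sublist_append_iff.1 hu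
  rw [List.length_append] at hlen
  obtain hqk | hqk := le_total q.length k
  · exact hp.append (h ⟨hq, hqk⟩).1
  · -- The last `k` letters go into `w'`, and the remaining ones, at most `n` many, into `a`.
    rw [← List.take_append_drop (q.length - k) q, ← List.append_assoc]
    refine List.Sublist.append (ha _ ?_) (h ⟨(List.drop_sublist _ _).trans hq, ?_⟩).1
    · simp only [List.length_append, List.length_take]
      omega
    · simp only [List.length_drop]
      omega

theorem scatFactLE_append_left (ha : IsUniversal n a) (h : scatFactLE k w = scatFactLE k w') :
    scatFactLE (k + n) (a ++ w) = scatFactLE (k + n) (a ++ w') :=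
  (scatFactLE_append_left_subset ha h.le).antisymm (scatFactLE_append_left_subset ha h.ge)

theorem scatFactLE_append_right_subset (ha : IsUniversal n a)
    (h : scatFactLE k w ⊆ scatFactLE k w') :
    scatFactLE (k + n) (w ++ a) ⊆ scatFactLE (k + n) (w' ++ a) := by
  rintro u ⟨hu, hlen⟩
  refine ⟨?_, hlen⟩
  obtain ⟨p, q, rfl, hp, hq⟩ := List.sublist_append_iff.1 hu
  rw [List.length_append] at hlen
  obtain hpk | hpk := le_total p.length k
  · exact (h ⟨hp, hpk⟩).1.append hq
  · rw [← List.take_append_drop k p, List.append_assoc]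
    refine List.Sublist.append (h ⟨(List.take_sublist _ _).trans hp, ?_⟩).1 (ha _ ?_)
    · exact List.length_take_le _ _
    · simp only [List.length_append, List.length_drop]
      omega

theorem scatFactLE_append_right (ha : IsUniversal n a) (h : scatFactLE k w = scatFactLE k w') :
    scatFactLE (k + n) (w ++ a) = scatFactLE (k + n) (w' ++ a) :=
  (scatFactLE_append_right_subset ha h.le).antisymm (scatFactLE_append_right_subset ha h.ge)

end ScatteredFactors

/-! ### Arches -/

section Arches

variable {A B : Type*} {k m : ℕ} {a a' w w' : List A}

theorem IsArch.eq_of_isPrefix (ha : IsArch a) (ha' : IsArch a') (h : a <+: a') : a = a' := by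
  obtain ⟨-, u, x, rfl, hx⟩ := ha'
  exact (List.prefix_concat_iff.1 h).resolve_right fun hu ↦ hx (hu.subset (ha.1 x))

theorem IsArch.append_inj (ha : IsArch a) (ha' : IsArch a') (h : a ++ w = a' ++ w') :
    a = a' ∧ w = w' := by
  have haa' : a = a' :=
    (List.prefix_or_prefix_of_prefix ⟨w, h⟩ ⟨w', rfl⟩).elim (ha.eq_of_isPrefix ha')
      fun h' ↦ (ha'.eq_of_isPrefix ha h').symm
  exact ⟨haa', List.append_cancel_left (haa' ▸ h)⟩

theorem IsArch.map (e : A ≃ B) (ha : IsArch a) : IsArch (a.map e) := by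
  obtain ⟨hall, u, x, rfl, hx⟩ := ha
  exact ⟨fun y ↦ List.mem_map.2 ⟨e.symm y, hall _, e.apply_symm_apply y⟩, u.map e, e x,
    List.map_append, by simpa using hx⟩

theorem scatFactLE_subset_of_isArch_append (ha : IsArch a) (ha' : IsArch a')
    (h : scatFactLE (k + 1) (a ++ w) ⊆ scatFactLE (k + 1) (a' ++ w')) :
    scatFactLE k w ⊆ scatFactLE k w' := by
  obtain ⟨-, u', x, rfl, hx⟩ := ha'
  rintro u ⟨hu, hlen⟩
  have hxu : x :: u ∈ scatFactLE (k + 1) (a ++ w) :=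
    ⟨(List.singleton_sublist.2 (ha.1 x)).append hu, Nat.succ_le_succ hlen⟩
  refine ⟨(cons_sublist_append_cons_iff hx).1 ?_, hlen⟩
  simpa only [List.append_assoc, List.singleton_append] using (h hxu).1

theorem scatFactLE_eq_of_isArch_append (ha : IsArch a) (ha' : IsArch a')
    (h : scatFactLE (k + 1) (a ++ w) = scatFactLE (k + 1) (a' ++ w')) :
    scatFactLE k w = scatFactLE k w' :=
  (scatFactLE_subset_of_isArch_append ha ha' h.le).antisymm
    (scatFactLE_subset_of_isArch_append ha' ha h.ge)

theorem hasArches_zero_iff : HasArches w 0 ↔ ∃ y, y ∉ w := by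
  constructor
  · rintro ⟨l, r, ⟨rfl, -, hr⟩, h0⟩
    obtain rfl := List.length_eq_zero_iff.1 h0
    exact hr
  · exact fun h ↦ ⟨[], w, ⟨rfl, List.forall_mem_nil _, h⟩, rfl⟩

theorem hasArches_succ_iff :
    HasArches w (m + 1) ↔ ∃ a w', w = a ++ w' ∧ IsArch a ∧ HasArches w' m := by
  constructor
  · rintro ⟨l, r, ⟨rfl, hl, hr⟩, hm⟩
    obtain ⟨a, l, rfl⟩ := List.exists_cons_of_length_eq_add_one hm
    obtain ⟨ha, hl⟩ := List.forall_mem_cons.1 hl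
    exact ⟨a, l.flatten ++ r, by simp, ha, l, r, ⟨rfl, hl, hr⟩, Nat.succ_injective hm⟩
  · rintro ⟨a, _, rfl, ha, l, r, ⟨rfl, hl, hr⟩, rfl⟩
    exact ⟨a :: l, r, ⟨by simp, List.forall_mem_cons.2 ⟨ha, hl⟩, hr⟩, rfl⟩

theorem HasArches.map (e : A ≃ B) (h : HasArches w m) : HasArches (w.map e) m := by
  induction m generalizing w with
  | zero =>
    obtain ⟨y, hy⟩ := hasArches_zero_iff.1 h
    exact hasArches_zero_iff.2 ⟨e y, by simpa using hy⟩
  | succ m ih =>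
    obtain ⟨a, w', rfl, ha, hw'⟩ := hasArches_succ_iff.1 h
    exact hasArches_succ_iff.2 ⟨a.map e, w'.map e, List.map_append, ha.map e, ih hw'⟩

end Arches

/-! ### Relabelling the alphabet -/

section Relabelling

variable {A B : Type*}

/-- The bijection between the `∼_k`-classes over two alphabets induced by a bijection of the
alphabets. -/
def simonQuotientCongr (e : A ≃ B) (k : ℕ) :
    Quotient (simonSetoid A k) ≃ Quotient (simonSetoid B k) :=
  Quotient.congr e.listEquivOfEquiv fun _ _ ↦ (scatFactLE_map_inj e).symm

theorem image_simonQuotientCongr_simonClasses (e : A ≃ B) (k m : ℕ) :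
    simonQuotientCongr e k '' simonClasses A k m = simonClasses B k m := by
  refine Set.Subset.antisymm ?_ ?_
  · rintro _ ⟨_, ⟨w, hw, rfl⟩, rfl⟩
    exact ⟨w.map e, hw.map e, rfl⟩
  · rintro _ ⟨w, hw, rfl⟩
    refine ⟨_, ⟨w.map e.symm, hw.map e.symm, rfl⟩, congrArg (Quotient.mk _) ?_⟩
    exact e.listEquivOfEquiv.apply_symm_apply w

theorem ncard_simonClasses_congr (e : A ≃ B) (k m : ℕ) :
    (simonClasses A k m).ncard = (simonClasses B k m).ncard := by
  rw [← image_simonQuotientCongr_simonClasses e,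
    Set.ncard_image_of_injective _ (simonQuotientCongr e k).injective]

theorem finite_simonClasses_congr (e : A ≃ B) (k m : ℕ) :
    (simonClasses A k m).Finite ↔ (simonClasses B k m).Finite := by
  rw [← image_simonQuotientCongr_simonClasses e,
    Set.finite_image_iff (simonQuotientCongr e k).injective.injOn]

end Relabelling

/-! ### The α-β-factorization -/

section AlphaBeta

variable {A : Type*} {m n : ℕ} {a α β α' w w' X X' u v : List A}

/-- `β` links the block `α` to the next block `α'` of an α-β-factorization: `αβ` is an arch read
from the left, and `βα'` is an arch read from the right. -/
structure IsLink (α β α' : List A) : Prop where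
  isArch : IsArch (α ++ β)
  isArch_reverse : IsArch (β ++ α').reverse
  ne_nil : β ≠ []

theorem IsLink.exists_notMem_left (h : IsLink α β α') : ∃ y, y ∉ α := by
  obtain ⟨-, u, x, hu, hx⟩ := h.isArch
  obtain ⟨β, y, rfl⟩ := (List.eq_nil_or_concat' β).resolve_left h.ne_nil
  rw [← List.append_assoc] at hu
  obtain ⟨rfl, -⟩ := List.append_inj' hu rfl
  exact ⟨x, fun hxα ↦ hx (List.mem_append_left β hxα)⟩

theorem IsLink.exists_cons (h : IsLink α β α') : ∃ r z, β ++ α' = r :: z ∧ r ∉ z := by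
  obtain ⟨-, z, r, hz, hr⟩ := h.isArch_reverse
  refine ⟨r, z.reverse, ?_, List.mem_reverse.not.2 hr⟩
  rw [← List.reverse_reverse (β ++ α'), hz, List.reverse_concat]

theorem IsLink.mem_append (h : IsLink α β α') (y : A) : y ∈ β ++ α' :=
  List.mem_reverse.1 (h.isArch_reverse.1 y)

theorem exists_eq_append_cons_of_forall_mem {p q : List A} (hpq : ∀ y, y ∈ p ++ q)
    (hq : ∃ y, y ∉ q) :
    ∃ p₁ r p₂, p = p₁ ++ r :: p₂ ∧ (∀ y, y ∈ r :: p₂ ++ q) ∧ r ∉ p₂ ++ q := by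
  induction p with
  | nil => exact absurd hpq (by simpa using hq)
  | cons b p ih =>
    by_cases hb : b ∈ p ++ q
    · have hpq' : ∀ y, y ∈ p ++ q := fun y ↦ (List.mem_cons.1 (hpq y)).elim (· ▸ hb) id
      obtain ⟨p₁, r, p₂, rfl, hall, hr⟩ := ih hpq'
      exact ⟨b :: p₁, r, p₂, rfl, hall, hr⟩
    · exact ⟨[], b, p, rfl, hpq, hb⟩

theorem IsArch.exists_isLink (ha : IsArch a) (hα' : ∃ y, y ∉ α') :
    ∃ α β, a = α ++ β ∧ IsLink α β α' := by
  obtain ⟨α, r, β, rfl, hall, hr⟩ := exists_eq_append_cons_of_forall_mem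
    (fun y ↦ List.mem_append_left α' (ha.1 y)) hα'
  refine ⟨α, r :: β, rfl, ha, ⟨fun y ↦ List.mem_reverse.2 (hall y), (β ++ α').reverse, r, ?_,
    List.mem_reverse.not.2 hr⟩, List.cons_ne_nil r β⟩
  rw [List.cons_append, List.reverse_cons]

/-- `IsAlphaBeta m α w` means that `w` has an α-β-factorization `α₀ β₁ α₁ ⋯ βₘ αₘ` with first
block `α₀ = α`. -/
inductive IsAlphaBeta : ℕ → List A → List A → Prop
  | block {α : List A} (hα : ∃ y, y ∉ α) : IsAlphaBeta 0 α α
  | append {m : ℕ} {α β α' w : List A} (hβ : IsLink α β α') :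
    IsAlphaBeta m α' w → IsAlphaBeta (m + 1) α (α ++ (β ++ w))

namespace IsAlphaBeta

theorem hasArches (h : IsAlphaBeta m α w) : HasArches w m := by
  induction h with
  | block hα => exact hasArches_zero_iff.2 hα
  | append hβ _ ih =>
    exact hasArches_succ_iff.2 ⟨_, _, (List.append_assoc ..).symm, hβ.isArch, ih⟩

theorem append_sublist (h : IsAlphaBeta m α w) (hv : v <+ X ++ α) (hu : u.length ≤ m) :
    v ++ u <+ X ++ w := by
  induction h generalizing X v u with
  | block => simpa [List.length_eq_zero_iff.1 (Nat.le_zero.1 hu)] using hv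
  | @append _ α β α' w hβ _ ih =>
    cases u with
    | nil => simpa using hv.trans ((List.prefix_append α (β ++ w)).sublist.append_left X)
    | cons r u =>
      have hvr : v ++ [r] <+ (X ++ α ++ β) ++ α' := by
        rw [List.append_assoc _ β]
        exact hv.append (List.singleton_sublist.2 (hβ.mem_append r))
      simpa using ih hvr (Nat.le_of_succ_le_succ hu)

theorem isUniversal_append (hw : IsAlphaBeta m α' w) (hβ : IsLink α β α') :
    IsUniversal (m + 1) (β ++ w)
  | [], _ => List.nil_sublist _
  | r :: _, hu => hw.append_sublist (v := [r]) (List.singleton_sublist.2 (hβ.mem_append r))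
      (Nat.le_of_succ_le_succ hu)

/-- The word `u` lists the last letters of the `m` arches read from the right, so its rightmost
embedding uses up everything behind the first block. -/
theorem exists_append_sublist_iff (h : IsAlphaBeta m α w) :
    ∃ u : List A, u.length = m ∧ ∀ X v, v ++ u <+ X ++ w ↔ v <+ X ++ α := by
  induction h with
  | block => exact ⟨[], rfl, fun X v ↦ by rw [List.append_nil]⟩
  | @append _ α β α' w hβ _ ih =>
    obtain ⟨u, hu, huw⟩ := ih
    obtain ⟨r, z, hrz, hr⟩ := hβ.exists_cons
    refine ⟨r :: u, congrArg Nat.succ hu, fun X v ↦ ?_⟩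
    calc v ++ r :: u <+ X ++ (α ++ (β ++ w))
      _ ↔ (v ++ [r]) ++ u <+ (X ++ α ++ β) ++ w := by simp
      _ ↔ v ++ [r] <+ (X ++ α) ++ r :: z := by rw [huw, List.append_assoc _ β, hrz]
      _ ↔ v <+ X ++ α := append_singleton_sublist_append_cons_iff hr

theorem scatFactLE_block_subset (h : IsAlphaBeta m α w) (h' : IsAlphaBeta m α' w')
    (hww' : scatFactLE (n + m) (X ++ w) ⊆ scatFactLE (n + m) (X' ++ w')) :
    scatFactLE n (X ++ α) ⊆ scatFactLE n (X' ++ α') := by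
  rintro v ⟨hv, hlen⟩
  obtain ⟨u, rfl, huw'⟩ := h'.exists_append_sublist_iff
  exact ⟨(huw' X' v).1 (hww' ⟨h.append_sublist hv le_rfl, by simpa using hlen⟩).1, hlen⟩

theorem scatFactLE_block_eq (h : IsAlphaBeta m α w) (h' : IsAlphaBeta m α' w')
    (hww' : scatFactLE (n + m) (X ++ w) = scatFactLE (n + m) (X' ++ w')) :
    scatFactLE n (X ++ α) = scatFactLE n (X' ++ α') :=
  (h.scatFactLE_block_subset h' hww'.le).antisymm (h'.scatFactLE_block_subset h hww'.ge)

end IsAlphaBeta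

end AlphaBeta

/-! ### Normal forms of binary words -/

section NormalForms

variable {t m : ℕ} {a α α₁ α' β β₁ w w₁ : List Bool}

theorem exists_notMem_iff_exists_eq_replicate :
    (∃ y, y ∉ α) ↔ ∃ n x, α = List.replicate n x := by
  constructor
  · rintro ⟨y, hy⟩
    refine ⟨α.length, !y, List.eq_replicate_iff.2 ⟨rfl, fun b hb ↦ ?_⟩⟩
    exact Bool.eq_not.2 (ne_of_mem_of_not_mem hb hy)
  · rintro ⟨n, x, rfl⟩
    exact ⟨!x, by simp⟩

theorem isArch_replicate_append_iff (x : Bool) (n : ℕ) :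
    IsArch (List.replicate n x ++ [!x]) ↔ n ≠ 0 := by
  constructor
  · rintro ⟨hall, -⟩ rfl
    simpa using hall x
  · exact fun hn ↦ ⟨fun y ↦ by cases x <;> cases y <;> simp [hn], _, _, rfl, by simp⟩

theorem IsArch.exists_eq_replicate_append (ha : IsArch a) :
    ∃ n x, a = List.replicate n x ++ [!x] := by
  obtain ⟨-, u, y, rfl, hy⟩ := ha
  refine ⟨u.length, !y, ?_⟩
  rw [Bool.not_not, ← List.eq_replicate_iff.2 ⟨rfl, fun b hb ↦ ?_⟩]
  exact Bool.eq_not.2 (ne_of_mem_of_not_mem hb hy)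

/-- The link in front of the block `α'` that completes a power of `x` to an arch. -/
def linkWord (x : Bool) (α' : List Bool) : List Bool :=
  if x ∈ α' then [!x] else [x, !x]

/-- The words that link the block `α` to the block `α'`, computed for binary words: the letter `x`
is the one occurring in the arch `αβ` before its last letter. -/
def links (α α' : List Bool) : Finset (List Bool) :=
  ({x | (∀ y ∈ α, y = x) ∧ (x ∈ α' → α ≠ [])} : Finset Bool).image (linkWord · α')

theorem mem_links_iff : β ∈ links α α' ↔ ∃ x, (∀ y ∈ α, y = x) ∧ (x ∈ α' → α ≠ []) ∧
    linkWord x α' = β := by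
  simp [links, and_assoc]

theorem IsLink.mem_links (h : IsLink α β α') : β ∈ links α α' := by
  obtain ⟨n, x, hn⟩ := h.isArch.exists_eq_replicate_append
  obtain ⟨β, y, rfl⟩ := (List.eq_nil_or_concat' β).resolve_left h.ne_nil
  rw [← List.append_assoc] at hn
  obtain ⟨hαβ, hy⟩ := List.append_inj' hn rfl
  obtain rfl := List.singleton_injective hy
  obtain ⟨-, hα, hβ⟩ := List.append_eq_replicate_iff.1 hαβ
  obtain ⟨r, z, hrz, hr⟩ := h.exists_cons
  refine mem_links_iff.2 ⟨x, fun y hy ↦ List.eq_of_mem_replicate (hα ▸ hy), ?_⟩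
  rw [hβ] at hrz h ⊢
  cases hl : β.length with
  | zero =>
    have hxα' : x ∈ α' := by simpa [hl] using h.mem_append x
    refine ⟨fun _ hα_nil ↦ ?_, by simp [linkWord, hxα']⟩
    simpa [hl, hα_nil] using h.isArch.1 x
  | succ l =>
    obtain ⟨rfl, rfl⟩ : x = r ∧ List.replicate l x ++ (!x) :: α' = z := by
      simpa [hl, List.replicate_succ] using hrz
    obtain ⟨rfl, hxα'⟩ : l = 0 ∧ x ∉ α' := by simpa using hr
    exact ⟨fun hx ↦ absurd hx hxα', by simp [linkWord, hxα']⟩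

theorem isLink_of_mem_links (hα' : ∃ y, y ∉ α') (h : β ∈ links α α') : IsLink α β α' := by
  obtain ⟨x, hα, hα0, rfl⟩ := mem_links_iff.1 h
  obtain ⟨n, rfl⟩ : ∃ n, α = List.replicate n x := ⟨_, List.eq_replicate_iff.2 ⟨rfl, hα⟩⟩
  by_cases hx : x ∈ α'
  · have hnx : (!x) ∉ α' := by
      obtain ⟨y, hy⟩ := hα'
      rwa [← Bool.eq_not.2 (ne_of_mem_of_not_mem hx hy).symm]
    have hn : n ≠ 0 := by simpa using hα0 hx
    simp only [linkWord, if_pos hx]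
    refine ⟨(isArch_replicate_append_iff x n).2 hn,
      ⟨fun y ↦ ?_, α'.reverse, !x, by simp, by simpa using hnx⟩, by simp⟩
    cases x <;> cases y <;> simp [hx]
  · simp only [linkWord, if_neg hx]
    refine ⟨?_, ⟨fun y ↦ ?_, α'.reverse ++ [!x], x, by simp, by simpa using hx⟩, by simp⟩
    · simpa [List.replicate_succ'] using (isArch_replicate_append_iff x (n + 1)).2 n.succ_ne_zero
    · cases x <;> cases y <;> simp

theorem linkWord_injective (α' : List Bool) : Function.Injective (linkWord · α') := by
  have hlast (x : Bool) : (linkWord x α').getLast? = some !x := by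
    unfold linkWord
    split_ifs <;> rfl
  intro x y hxy
  simpa [hlast] using congrArg List.getLast? hxy

theorem card_links (hα : ∃ y, y ∉ α) (hα' : ∃ y, y ∉ α') :
    #(links α α') = if α = [] ∧ α' = [] then 2 else 1 := by
  rw [links, Finset.card_image_of_injective _ (linkWord_injective α')]
  obtain ⟨n, x, rfl⟩ := exists_notMem_iff_exists_eq_replicate.1 hα
  obtain ⟨n', x', rfl⟩ := exists_notMem_iff_exists_eq_replicate.1 hα'
  obtain rfl | hn := eq_or_ne n 0
  · obtain rfl | hn' := eq_or_ne n' 0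
    · simp
    · simpa [hn'] using show #({y | y ≠ x'} : Finset Bool) = 1 by cases x' <;> rfl
  · simpa [hn] using show #({y | x = y} : Finset Bool) = 1 by cases x <;> rfl

/-- The possible blocks of a normal form: the powers of a letter with exponent at most `t`. -/
def blocks (t : ℕ) : Finset (List Bool) :=
  insert [] ((Finset.univ ×ˢ Finset.range t).image fun p : Bool × ℕ ↦ List.replicate (p.2 + 1) p.1)

theorem mem_blocks : α ∈ blocks t ↔ (∃ y, y ∉ α) ∧ α.length ≤ t := by
  rw [exists_notMem_iff_exists_eq_replicate]
  constructor
  · simp only [blocks, Finset.mem_insert, Finset.mem_image]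
    rintro (rfl | ⟨⟨x, j⟩, hj, rfl⟩)
    · simp
    · exact ⟨⟨_, _, rfl⟩, by simpa using hj⟩
  · rintro ⟨⟨_ | n, x, rfl⟩, hn⟩
    · simp [blocks]
    · exact Finset.mem_insert_of_mem (Finset.mem_image.2 ⟨(x, n), by simpa using hn, rfl⟩)

theorem sum_blocks (t : ℕ) (f : List Bool → ℕ) :
    ∑ α ∈ blocks t, f α = f [] + ∑ x, ∑ j ∈ Finset.range t, f (List.replicate (j + 1) x) := by
  rw [blocks, Finset.sum_insert (by simp), Finset.sum_image, Finset.sum_product]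
  rintro ⟨x, i⟩ - ⟨y, j⟩ - h
  simpa [List.replicate_inj, and_comm] using h

/-- The words whose α-β-factorization has `m` links, first block `α` and all later blocks in
`blocks t`. -/
def normalForms (t : ℕ) : ℕ → List Bool → Finset (List Bool)
  | 0, α => {α}
  | m + 1, α => ((blocks t).sigma fun α' ↦ links α α' ×ˢ normalForms t m α').image
      fun p ↦ α ++ (p.2.1 ++ p.2.2)

theorem mem_normalForms_succ : w ∈ normalForms t (m + 1) α ↔ ∃ α' ∈ blocks t, ∃ β ∈ links α α',
    ∃ w' ∈ normalForms t m α', w = α ++ (β ++ w') := by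
  simp only [normalForms, Finset.mem_image, Finset.mem_sigma, Finset.mem_product, Sigma.exists,
    Prod.exists]
  constructor
  · rintro ⟨α', β, w', ⟨hα', hβ, hw'⟩, rfl⟩
    exact ⟨α', hα', β, hβ, w', hw', rfl⟩
  · rintro ⟨α', hα', β, hβ, w', hw', rfl⟩
    exact ⟨α', β, w', ⟨hα', hβ, hw'⟩, rfl⟩

theorem isAlphaBeta_of_mem_normalForms (hα : ∃ y, y ∉ α) (hw : w ∈ normalForms t m α) :
    IsAlphaBeta m α w := by
  induction m generalizing α w with
  | zero =>
    obtain rfl := Finset.mem_singleton.1 hw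
    exact .block hα
  | succ m ih =>
    obtain ⟨α', hα', β, hβ, w', hw', rfl⟩ := mem_normalForms_succ.1 hw
    have hα' := (mem_blocks.1 hα').1
    exact .append (isLink_of_mem_links hα' hβ) (ih hα' hw')

theorem block_eq_of_scatFactLE_eq (hα : α ∈ blocks t) (hα₁ : α₁ ∈ blocks t)
    (hw : w ∈ normalForms t m α) (hw₁ : w₁ ∈ normalForms t m α₁)
    (h : scatFactLE (t + m) w = scatFactLE (t + m) w₁) : α = α₁ := by
  rw [mem_blocks] at hα hα₁
  exact eq_of_scatFactLE_eq hα.2 hα₁.2 <|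
    (isAlphaBeta_of_mem_normalForms hα.1 hw).scatFactLE_block_eq (X := []) (X' := [])
      (isAlphaBeta_of_mem_normalForms hα₁.1 hw₁) h

/-- Only between empty blocks is there a choice, and then both links have length two. -/
theorem link_eq_of_scatFactLE_eq {n : ℕ} (hn : 2 ≤ n) (hα : ∃ y, y ∉ α) (hα' : ∃ y, y ∉ α')
    (hβ : β ∈ links α α') (hβ₁ : β₁ ∈ links α α')
    (h : scatFactLE n (α ++ β ++ α') = scatFactLE n (α ++ β₁ ++ α')) : β = β₁ := by
  by_cases hαα' : α = [] ∧ α' = []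
  · have hlen : ∀ γ ∈ links [] [], γ.length = 2 := by decide
    obtain ⟨rfl, rfl⟩ := hαα'
    simp only [List.nil_append, List.append_nil] at h
    exact eq_of_scatFactLE_eq ((hlen β hβ).trans_le hn) ((hlen β₁ hβ₁).trans_le hn) h
  · have hcard : #(links α α') ≤ 1 := by rw [card_links hα hα', if_neg hαα']
    exact Finset.card_le_one.1 hcard β hβ β₁ hβ₁

theorem eq_of_mem_normalForms_of_scatFactLE_eq (ht : 0 < t) (hα : α ∈ blocks t)
    (hα₁ : α₁ ∈ blocks t) (hw : w ∈ normalForms t m α) (hw₁ : w₁ ∈ normalForms t m α₁)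
    (h : scatFactLE (t + m) w = scatFactLE (t + m) w₁) : w = w₁ := by
  induction m generalizing α α₁ w w₁ with
  | zero =>
    rw [Finset.mem_singleton.1 hw, Finset.mem_singleton.1 hw₁]
    exact block_eq_of_scatFactLE_eq hα hα₁ hw hw₁ h
  | succ m ih =>
    obtain rfl := block_eq_of_scatFactLE_eq hα hα₁ hw hw₁ h
    obtain ⟨α', hα', β, hβ, u, hu, rfl⟩ := mem_normalForms_succ.1 hw
    obtain ⟨α₁', hα₁', β₁, hβ₁, u₁, hu₁, rfl⟩ := mem_normalForms_succ.1 hw₁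
    have hα'_miss := (mem_blocks.1 hα').1
    have hα₁'_miss := (mem_blocks.1 hα₁').1
    rw [← List.append_assoc, ← List.append_assoc α] at h
    have huu₁ : scatFactLE (t + m) u = scatFactLE (t + m) u₁ :=
      scatFactLE_eq_of_isArch_append (isLink_of_mem_links hα'_miss hβ).isArch
        (isLink_of_mem_links hα₁'_miss hβ₁).isArch h
    obtain rfl := block_eq_of_scatFactLE_eq hα' hα₁' hu hu₁ huu₁
    obtain rfl := ih hα' hα₁' hu hu₁ huu₁
    have hββ₁ : scatFactLE (t + 1) (α ++ β ++ α') = scatFactLE (t + 1) (α ++ β₁ ++ α') := by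
      have hu := isAlphaBeta_of_mem_normalForms hα'_miss hu
      rw [← add_assoc, add_right_comm] at h
      exact hu.scatFactLE_block_eq hu h
    rw [link_eq_of_scatFactLE_eq (Nat.succ_le_succ ht) (mem_blocks.1 hα).1 hα'_miss hβ hβ₁ hββ₁]

theorem exists_scatFactLE_eq_of_hasArches (ht : 0 < t) (hw : HasArches w m) :
    ∃ α ∈ blocks t, ∃ w₁ ∈ normalForms t m α, scatFactLE (t + m) w₁ = scatFactLE (t + m) w := by
  have hmin_mem (n : ℕ) (x : Bool) : List.replicate (min n t) x ∈ blocks t :=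
    mem_blocks.2 ⟨⟨!x, by simp⟩, by simp⟩
  induction m generalizing w with
  | zero =>
    obtain ⟨n, x, rfl⟩ := exists_notMem_iff_exists_eq_replicate.1 (hasArches_zero_iff.1 hw)
    exact ⟨_, hmin_mem n x, _, Finset.mem_singleton_self _, scatFactLE_replicate_min t n x⟩
  | succ m ih =>
    obtain ⟨a, w', rfl, ha, hw'⟩ := hasArches_succ_iff.1 hw
    obtain ⟨α', hα', w₁, hw₁, hww₁⟩ := ih hw'
    have hα'_miss := (mem_blocks.1 hα').1
    obtain ⟨α, β, rfl, hβ⟩ := ha.exists_isLink hα'_miss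
    obtain ⟨n, x, rfl⟩ := exists_notMem_iff_exists_eq_replicate.1 hβ.exists_notMem_left
    have hβ_mem : β ∈ links (List.replicate (min n t) x) α' := by
      have : (min n t = 0 ↔ n = 0) := by omega
      simpa [mem_links_iff, this] using hβ.mem_links
    refine ⟨_, hmin_mem n x, _, mem_normalForms_succ.2 ⟨α', hα', β, hβ_mem, w₁, hw₁, rfl⟩, ?_⟩
    have hβw₁ : IsUniversal (m + 1) (β ++ w₁) :=
      (isAlphaBeta_of_mem_normalForms hα'_miss hw₁).isUniversal_append hβ
    calc scatFactLE (t + (m + 1)) (List.replicate (min n t) x ++ (β ++ w₁))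
      _ = scatFactLE (t + (m + 1)) (List.replicate n x ++ (β ++ w₁)) :=
        scatFactLE_append_right hβw₁ (scatFactLE_replicate_min t n x)
      _ = scatFactLE (t + m + 1) (List.replicate n x ++ β ++ w₁) := by
        rw [List.append_assoc, add_assoc]
      _ = scatFactLE (t + (m + 1)) (List.replicate n x ++ β ++ w') :=
        scatFactLE_append_left (isUniversal_one_of_forall_mem ha.1) hww₁

end NormalForms

/-! ### Counting normal forms -/

section Counting

variable {t m : ℕ} {α : List Bool}

/-- All normal forms with `m` arches and blocks in `blocks t`; they represent the `∼_{t+m}`-classes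
of the binary words with `m` arches. -/
def allNormalForms (t m : ℕ) : Finset (List Bool) :=
  (blocks t).biUnion (normalForms t m)

theorem simonClasses_bool_eq_image (ht : 0 < t) (m : ℕ) :
    simonClasses Bool (t + m) m =
      Quotient.mk (simonSetoid Bool (t + m)) '' (allNormalForms t m : Set (List Bool)) := by
  ext q
  simp only [Set.mem_image, allNormalForms, Finset.mem_coe, Finset.mem_biUnion]
  constructor
  · rintro ⟨w, hw, rfl⟩
    obtain ⟨α, hα, w₁, hw₁, hww₁⟩ := exists_scatFactLE_eq_of_hasArches ht hw
    exact ⟨w₁, ⟨α, hα, hw₁⟩, Quotient.sound hww₁⟩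
  · rintro ⟨w, ⟨α, hα, hw⟩, rfl⟩
    exact ⟨w, (isAlphaBeta_of_mem_normalForms (mem_blocks.1 hα).1 hw).hasArches, rfl⟩

theorem injOn_quotientMk_allNormalForms (ht : 0 < t) (m : ℕ) :
    Set.InjOn (Quotient.mk (simonSetoid Bool (t + m))) (allNormalForms t m : Set (List Bool)) := by
  intro w hw w₁ hw₁ h
  obtain ⟨α, hα, hw⟩ := Finset.mem_biUnion.1 hw
  obtain ⟨α₁, hα₁, hw₁⟩ := Finset.mem_biUnion.1 hw₁
  exact eq_of_mem_normalForms_of_scatFactLE_eq ht hα hα₁ hw hw₁ (Quotient.exact h)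

theorem ncard_simonClasses_bool (ht : 0 < t) (m : ℕ) :
    (simonClasses Bool (t + m) m).ncard = #(allNormalForms t m) := by
  rw [simonClasses_bool_eq_image ht, (injOn_quotientMk_allNormalForms ht m).ncard_image,
    Set.ncard_coe_finset]

theorem card_allNormalForms (t m : ℕ) :
    #(allNormalForms t m) = ∑ α ∈ blocks t, #(normalForms t m α) := by
  refine Finset.card_biUnion fun α hα α₁ hα₁ hne ↦ Finset.disjoint_left.2 fun w hw hw₁ ↦ ?_
  exact hne (block_eq_of_scatFactLE_eq hα hα₁ hw hw₁ rfl)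

theorem card_normalForms_succ_eq_sum (t m : ℕ) (α : List Bool) :
    #(normalForms t (m + 1) α) = ∑ α' ∈ blocks t, #(links α α') * #(normalForms t m α') := by
  rw [normalForms, Finset.card_image_of_injOn, Finset.card_sigma]
  · simp only [Finset.card_product]
  rintro ⟨α', β, w⟩ h ⟨α₁', β₁, w₁⟩ h₁ heq
  simp only [Finset.mem_coe, Finset.mem_sigma, Finset.mem_product] at h h₁
  obtain ⟨hα', hβ, hw⟩ := h
  obtain ⟨hα₁', hβ₁, hw₁⟩ := h₁
  simp only [← List.append_assoc] at heq
  obtain ⟨hββ₁, rfl⟩ := (isLink_of_mem_links (mem_blocks.1 hα').1 hβ).isArch.append_inj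
    (isLink_of_mem_links (mem_blocks.1 hα₁').1 hβ₁).isArch heq
  obtain rfl := List.append_cancel_left hββ₁
  obtain rfl := block_eq_of_scatFactLE_eq hα' hα₁' hw hw₁ rfl
  rfl

theorem card_normalForms_succ (hα : ∃ y, y ∉ α) :
    #(normalForms t (m + 1) α) =
      #(allNormalForms t m) + if α = [] then #(normalForms t m []) else 0 := by
  have hterm : ∀ α' ∈ blocks t, #(links α α') * #(normalForms t m α') =
      #(normalForms t m α') + if α = [] ∧ α' = [] then #(normalForms t m []) else 0 := by
    intro α' hα'
    rw [card_links hα (mem_blocks.1 hα').1]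
    split_ifs with h
    · rw [h.2, two_mul]
    · rw [one_mul, add_zero]
  have hnil : [] ∈ blocks t := Finset.mem_insert_self _ _
  rw [card_normalForms_succ_eq_sum, Finset.sum_congr rfl hterm, Finset.sum_add_distrib,
    ← card_allNormalForms]
  by_cases hα_nil : α = []
  · simp [hα_nil, hnil]
  · simp [hα_nil]

/-- The number of normal forms with `m` arches whose first block is a nonempty power of `x`. -/
def powerBlockCount (t m : ℕ) (x : Bool) : ℕ :=
  ∑ j ∈ Finset.range t, #(normalForms t m (List.replicate (j + 1) x))

theorem card_allNormalForms_eq_add (t m : ℕ) :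
    #(allNormalForms t m) =
      powerBlockCount t m true + #(normalForms t m []) + powerBlockCount t m false := by
  rw [card_allNormalForms, sum_blocks, Fintype.sum_bool]
  simp only [powerBlockCount]
  ring

theorem powerBlockCount_zero (t : ℕ) (x : Bool) : powerBlockCount t 0 x = t := by
  simp [powerBlockCount, normalForms]

theorem powerBlockCount_succ (t m : ℕ) (x : Bool) :
    powerBlockCount t (m + 1) x = t * #(allNormalForms t m) := by
  have hcard (j : ℕ) : #(normalForms t (m + 1) (List.replicate (j + 1) x)) =
      #(allNormalForms t m) := by
    simp [card_normalForms_succ (exists_notMem_iff_exists_eq_replicate.2 ⟨j + 1, x, rfl⟩)]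
  simp [powerBlockCount, hcard]

theorem card_normalForms_nil_zero (t : ℕ) : #(normalForms t 0 []) = 1 :=
  Finset.card_singleton []

theorem card_normalForms_nil_succ (t m : ℕ) :
    #(normalForms t (m + 1) []) = #(allNormalForms t m) + #(normalForms t m []) := by
  simp [card_normalForms_succ]

theorem archMatrix_pow_mulVec_archVector (t m n : ℕ) :
    (archMatrix (t + m) m ^ n).mulVec (archVector (t + m) m) =
      ![(powerBlockCount t n true : ℝ), #(normalForms t n []), powerBlockCount t n false] := by
  induction n with
  | zero => simp [archVector, powerBlockCount_zero, card_normalForms_nil_zero]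
  | succ n ih =>
    rw [pow_succ', ← Matrix.mulVec_mulVec, ih, powerBlockCount_succ, powerBlockCount_succ,
      card_normalForms_nil_succ, card_allNormalForms_eq_add]
    ext i
    fin_cases i <;> simp [archMatrix, Matrix.mulVec, dotProduct, Fin.sum_univ_three] <;> ring

theorem norm_archMatrix_pow_mulVec_archVector (t m n : ℕ) :
    ‖WithLp.toLp 1 ((archMatrix (t + m) m ^ n).mulVec (archVector (t + m) m))‖ =
      #(allNormalForms t n) := by
  rw [archMatrix_pow_mulVec_archVector, PiLp.norm_eq_of_L1, card_allNormalForms_eq_add]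
  simp [Fin.sum_univ_three]

theorem archRec_add_add_one (t : ℤ) {m : ℤ} (hm : 0 ≤ m) :
    archRec (t + m + 1) (m + 1) =
      2 * (t + 1) * archRec (t + m) m - 2 * t * archRec (t + m - 1) (m - 1) := by
  convert archRec_rec (t + m + 1) (m + 1) (by omega) using 4 <;> ring

/-- The recursion for `archRec` arises by eliminating the count of the normal forms with empty first
block, which the second conjunct expresses through two consecutive values of `archRec`. -/
theorem archRec_eq_card_and_card_nil_eq (t m : ℕ) :
    archRec (t + m) m = #(allNormalForms t m) ∧
      (#(normalForms t m []) : ℤ) = archRec (t + m) m - 2 * t * archRec (t + m - 1) (m - 1) := by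
  induction m with
  | zero =>
    rw [card_allNormalForms_eq_add, powerBlockCount_zero, powerBlockCount_zero,
      card_normalForms_nil_zero]
    simp only [Nat.cast_zero, zero_sub, archRec_zero, archRec_neg_one]
    constructor <;> push_cast <;> ring
  | succ m ih =>
    obtain ⟨hall, hnil⟩ := ih
    rw [card_allNormalForms_eq_add, powerBlockCount_succ, powerBlockCount_succ,
      card_normalForms_nil_succ]
    push_cast
    rw [← add_assoc, archRec_add_add_one t m.cast_nonneg, add_sub_cancel_right,
      add_sub_cancel_right]
    constructor
    · linear_combination (2 * (t : ℤ) + 1) * hall - hnil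
    · linear_combination hnil - hall

end Counting

theorem mainTheorem4 {A : Type*} (hA : Nat.card A = 2) (k m : ℕ) (hmk : m < k) :
    (simonClasses A k m).Finite ∧
    ((simonClasses A k m).ncard : ℝ) =
      ‖WithLp.toLp 1 (Matrix.mulVec (archMatrix k m ^ m) (archVector k m))‖ ∧
    ‖WithLp.toLp 1 (Matrix.mulVec (archMatrix k m ^ m) (archVector k m))‖ =
      ((archRec (k : ℤ) (m : ℤ) : ℤ) : ℝ) := by
  have : Finite A := Nat.finite_of_card_ne_zero (by omega)
  obtain ⟨e⟩ : Nonempty (A ≃ Bool) := Finite.card_eq.1 (by simp [hA])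
  obtain ⟨t, rfl⟩ := Nat.exists_eq_add_of_le' hmk.le
  have ht : 0 < t := by omega
  rw [finite_simonClasses_congr e, ncard_simonClasses_congr e, ncard_simonClasses_bool ht,
    norm_archMatrix_pow_mulVec_archVector, Nat.cast_add,
    (archRec_eq_card_and_card_nil_eq t m).1, Int.cast_natCast, simonClasses_bool_eq_image ht]
  exact ⟨(allNormalForms t m).finite_toSet.image _, rfl, rfl⟩
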